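/- Let $n>2$, let $(G,\cdot)$ be a group, $\theta$ an automorphism of it and $b\in G$ with $\theta(b)=b$ and $\theta^{n-1}(x)=bxb^{-1}$ for all $x\in G$, and let $(G,f)$ be the $n$-ary group with $f(x_1,\dots,x_n)=x_1\theta(x_2)\theta^2(x_3)\cdots\theta^{n-1}(x_n)b$ (by the Hosszú–Gluskin theorem, every $n$-ary group has this form). Definitions. A *polyadic group over $G$* is an $n$-ary group $H$ together with a homomorphism $\gamma:G\to H$ that gives the values of the constants from $G$; it is *finitely generated* if finitely many elements together with $\gamma(G)$ generate it. For $X=\{x_1,\dots,x_m\}$ let $G[X]$ be the free product of $(G,f)$ and the free $n$-ary group on $X$; its elements are the polyadic terms with coefficients from $G$. A system is a set $S\subseteq G[X]\times G[X]$ of equations $p\approx q$, and $V_G(S)\subseteq G^m$ is its set of solutions; such sets are called algebraic. $(G,f)$ is *equational noetherian* if for every $m$ each system $S$ in $m$ variables has a finite subsystem $S_0$ with $V_G(S)=V_G(S_0)$. The Zariski topology on $G^m$ has the algebraic sets as a subbase of its closed sets; an algebraic set is *irreducible* if it is non-empty and is not the union of two proper relatively closed subsets. For $Y\subseteq G^m$,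 $\mathrm{Rad}(Y)$ is the set of the pairs $(p,q)\in G[X]^2$ with $p(y)=q(y)$ for all $y\in Y$, and $\Gamma(Y)=G[X]/\mathrm{Rad}(Y)$, with the constants $g\mapsto[g]$, is the *coordinate polyadic group* of $Y$. For an ultrafilter $F$ on a set $I$, $\theta^*$ denotes the automorphism of $G^I/F$ induced by $\theta$; the ultrapower $(G,f)^I/F$ is the $n$-ary group obtained from $G^I/F$, $\theta^*$ and the class of the constant family $b$ as above, and is a polyadic group over $G$ through the constant families. For $u\in G^I/F$, $(G^I/F)_u$ is the set $G^I/F$ with the group operation $x*y=xu^{-1}y$. **Theorem.** Let $(G,f)$ be equational noetherian and let $H$ be a polyadic group over $G$. Consider the condition: (∗) there are a set $I$, an ultrafilter $F$ on $I$ and an element $u=(u_i)/F\in G^I/F$ such that $H$ is isomorphic, over $G$, to a polyadic subgroup $S$ of $(G,f)^I/F$ with the following properties: 1. $S$ is a subgroup of the ordinary group $(G^I/F)_u$; 2. for all $(h_i)/F\in S$, we have $(u_i\theta(h_i)\theta(u_i^{-1}))/F\in S$. If $H$ is isomorphic over $G$ to the coordinate polyadic group of an irreducible algebraic set in some $G^m$,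 then (∗) holds. Conversely, if $H$ is finitely generated (as a polyadic group over $G$) and (∗) holds, then $H$ is isomorphic over $G$ to the coordinate polyadic group of an irreducible algebraic set in some $G^m$, $m\ge 1$. -/

import Mathlib

universe u v w

noncomputable section

namespace Polyadic

/-- For a sequence `x 0, x 1, …` and a place `i < n`, the `n`-tuple
`(x 0, …, x (i-1), op (x i, …, x (i+n-1)), x (i+n), …, x (2n-2))`. Only the terms
`x 0, …, x (2n-2)` of the sequence are used. -/
def splice {n : ℕ} {A : Type*} (op : (Fin n → A) → A) (x : ℕ → A) (i : Fin n) : Fin n → A :=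
  fun k => if k < i then x k else if k = i then op (fun l => x (i + l)) else x (k + (n - 1))

/-- An `n`-ary (polyadic) group structure on `G`: an associative `n`-ary operation for which every
equation `op (a_1, …, a_{i-1}, x, a_{i+1}, …, a_n) = b` has exactly one solution `x`. (The entry
`a i` of the tuple `a` plays no role, as it is overwritten by `x`.) -/
structure PolyadicGroup (n : ℕ) (G : Type u) where
  op : (Fin n → G) → G
  nonempty : Nonempty G
  assoc : ∀ (x : ℕ → G) (i j : Fin n), op (splice op x i) = op (splice op x j)
  existsUnique_solution : ∀ (a : Fin n → G) (c : G) (i : Fin n),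
    ∃! x : G, op (Function.update a i x) = c

variable {n : ℕ}

/-- Homomorphisms of polyadic groups. -/
def IsHom {G : Type u} {H : Type v} (P : PolyadicGroup n G) (Q : PolyadicGroup n H)
    (φ : G → H) : Prop :=
  ∀ x : Fin n → G, φ (P.op x) = Q.op (fun i => φ (x i))

/-- Polyadic subgroups: non-empty subsets closed under the operation and under taking solutions of
the equations `op (a_1, …, x, …, a_n) = c`. -/
structure IsPolyadicSubgroup {G : Type u} (P : PolyadicGroup n G) (K : Set G) : Prop where
  nonempty : K.Nonempty
  op_mem : ∀ x : Fin n → G, (∀ i, x i ∈ K) → P.op x ∈ K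
  solution_mem : ∀ (a : Fin n → G) (c : G) (i : Fin n) (x : G),
    (∀ j, j ≠ i → a j ∈ K) → c ∈ K → P.op (Function.update a i x) = c → x ∈ K

/-- `H`, equipped with a map `γ : G → H` giving the values of the constants from `G`, is finitely
generated as a polyadic group with constants from `G`. -/
def FinitelyGeneratedOver {G : Type u} {H : Type v} (Q : PolyadicGroup n H) (γ : G → H) : Prop :=
  ∃ t : Finset H, ∀ K : Set H, IsPolyadicSubgroup Q K →
    (∀ g, γ g ∈ K) → (∀ h ∈ t, h ∈ K) → K = Set.univ

namespace PolyadicGroup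

variable {G : Type u} (P : PolyadicGroup n G)

/-- The solution `x` of `op (a_1, …, a_{i-1}, x, a_{i+1}, …, a_n) = c`. -/
def sol (i : Fin n) (a : Fin n → G) (c : G) : G :=
  (P.existsUnique_solution a c i).choose

theorem op_sol (i : Fin n) (a : Fin n → G) (c : G) :
    P.op (Function.update a i (P.sol i a c)) = c :=
  (P.existsUnique_solution a c i).choose_spec.1

theorem sol_op (i : Fin n) (a : Fin n → G) (x : G) :
    P.sol i a (P.op (Function.update a i x)) = x :=
  ((P.existsUnique_solution a _ i).choose_spec.2 x rfl).symm

end PolyadicGroup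

/-! ### The polyadic groups `der_{θ,b}(G,·)` -/

section Der

variable {G : Type u} [Group G]

/-- `x_1 θ(x_2) θ²(x_3) ⋯ θ^{n-1}(x_n) b`. -/
def derOp (θ : MulAut G) (b : G) (x : Fin n → G) : G :=
  (List.ofFn fun i : Fin n => (θ ^ (i : ℕ)) (x i)).prod * b

/-- The product of `θ^l (x l)` over `l < k`, in increasing order. -/
def partialProd (θ : MulAut G) (x : ℕ → G) : ℕ → G
  | 0 => 1
  | k + 1 => partialProd θ x k * (θ ^ k) (x k)

theorem partialProd_eq (θ : MulAut G) (x : ℕ → G) (k : ℕ) :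
    (List.ofFn fun i : Fin k => (θ ^ (i : ℕ)) (x i)).prod = partialProd θ x k := by
  induction k with
  | zero => simp [partialProd]
  | succ k ih =>
    rw [List.ofFn_succ', List.prod_concat]
    simp only [Fin.val_castSucc, Fin.val_last, partialProd]
    rw [ih]

theorem partialProd_congr (θ : MulAut G) {x y : ℕ → G} {k : ℕ} (h : ∀ l < k, x l = y l) :
    partialProd θ x k = partialProd θ y k := by
  induction k with
  | zero => rfl
  | succ k ih =>
    simp only [partialProd]
    rw [ih (fun l hl => h l (by omega)), h k (by omega)]

theorem partialProd_add (θ : MulAut G) (x : ℕ → G) (k l : ℕ) :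
    partialProd θ x (k + l) =
      partialProd θ x k * (θ ^ k) (partialProd θ (fun j => x (k + j)) l) := by
  induction l with
  | zero => simp [partialProd]
  | succ l ih =>
    rw [← add_assoc]
    simp only [partialProd]
    rw [ih, map_mul, mul_assoc, pow_add]
    rfl

theorem pow_apply_fixed (θ : MulAut G) (b : G) (hb : θ b = b) (k : ℕ) : (θ ^ k) b = b := by
  induction k with
  | zero => rfl
  | succ k ih => rw [pow_succ', MulAut.mul_apply, ih, hb]

theorem derOp_seq (θ : MulAut G) (b : G) (x : ℕ → G) :
    derOp θ b (fun i : Fin n => x i) = partialProd θ x n * b := by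
  rw [derOp, partialProd_eq]

/-- All ways of bracketing give `x_0 θ(x_1) ⋯ θ^{2n-2}(x_{2n-2}) b²`. -/
theorem derOp_splice (θ : MulAut G) (b : G) (hb : θ b = b)
    (hθ : ∀ x, (θ ^ (n - 1)) x = b * x * b⁻¹) (x : ℕ → G) (i : Fin n) :
    derOp θ b (splice (derOp θ b) x i) = partialProd θ x (2 * n - 1) * b * b := by
  have hi := i.isLt
  set y : ℕ → G := fun k => if k < (i : ℕ) then x k else
    if k = (i : ℕ) then derOp θ b (fun l : Fin n => x (i + l)) else x (k + (n - 1)) with hy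
  have h1 : splice (derOp θ b) x i = fun k : Fin n => y k := by
    funext k
    simp only [splice, hy, Fin.lt_def, Fin.ext_iff]
  rw [h1, derOp_seq]
  obtain ⟨r, hr⟩ : ∃ r, n = i + 1 + r := ⟨n - (i + 1), by omega⟩
  have h2 : partialProd θ y n = partialProd θ y (i + 1 + r) := by rw [← hr]
  have h3 : partialProd θ x (2 * n - 1) = partialProd θ x (i + n + r) := by
    congr 1; omega
  rw [h2, h3, partialProd_add θ y, partialProd_add θ x (i + n), partialProd_add θ x i n]
  have h4 : partialProd θ y i = partialProd θ x i :=
    partialProd_congr θ (fun l hl => by simp [hy, hl])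
  have h5 : y i = partialProd θ (fun j => x (i + j)) n * b := by
    simp only [hy, lt_irrefl, if_false, if_true]
    exact derOp_seq θ b (fun j => x (i + j))
  have h6 : partialProd θ (fun j => y (i + 1 + j)) r =
      partialProd θ (fun j => x (i + n + j)) r := by
    refine partialProd_congr θ (fun l _ => ?_)
    simp only [hy]
    rw [if_neg (by omega), if_neg (by omega)]
    congr 1; omega
  have h7 : partialProd θ y (i + 1) = partialProd θ y i * (θ ^ (i : ℕ)) (y i) := rfl
  rw [h7, h4, h5, h6, map_mul, pow_apply_fixed θ b hb]
  set A := partialProd θ (fun j => x (i + n + j)) r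
  have h8 : (θ ^ ((i : ℕ) + n)) A = b * (θ ^ ((i : ℕ) + 1)) A * b⁻¹ := by
    rw [← hθ, ← MulAut.mul_apply, ← pow_add]
    congr 2; omega
  rw [h8]
  group

theorem derOp_existsUnique (θ : MulAut G) (b : G) (a : Fin n → G) (c : G) (i : Fin n) :
    ∃! x : G, derOp θ b (Function.update a i x) = c := by
  have hi := i.isLt
  obtain ⟨r, hr⟩ : ∃ r, n = i + 1 + r := ⟨n - (i + 1), by omega⟩
  set s : ℕ → G := fun k => if h : k < n then a ⟨k, h⟩ else 1 with hs
  have key : ∀ x : G, derOp θ b (Function.update a i x) =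
      partialProd θ s i * (θ ^ (i : ℕ)) x *
        ((θ ^ ((i : ℕ) + 1)) (partialProd θ (fun j => s (i + 1 + j)) r) * b) := by
    intro x
    have h1 : Function.update a i x =
        fun k : Fin n => Function.update s (i : ℕ) x k := by
      funext k
      by_cases hk : k = i
      · subst hk; simp
      · have : (k : ℕ) ≠ i := fun h => hk (Fin.ext h)
        simp [Function.update_of_ne hk, Function.update_of_ne this, hs]
    rw [h1, derOp_seq]
    have h2 : partialProd θ (Function.update s (i : ℕ) x) n =
        partialProd θ (Function.update s (i : ℕ) x) (i + 1 + r) := by rw [← hr]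
    rw [h2, partialProd_add]
    have h3 : partialProd θ (Function.update s (i : ℕ) x) (i + 1) =
      partialProd θ (Function.update s (i : ℕ) x) i *
        (θ ^ (i : ℕ)) (Function.update s (i : ℕ) x i) := rfl
    rw [h3, Function.update_self]
    rw [partialProd_congr θ (x := Function.update s (i : ℕ) x) (y := s)
      (fun l hl => Function.update_of_ne (by omega) _ _)]
    rw [partialProd_congr θ (x := fun j => Function.update s (i : ℕ) x (i + 1 + j))
      (y := fun j => s (i + 1 + j)) (fun l _ => Function.update_of_ne (by omega) _ _)]
    group
  set L := partialProd θ s i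
  set R := (θ ^ ((i : ℕ) + 1)) (partialProd θ (fun j => s (i + 1 + j)) r) * b
  refine ⟨(θ ^ (i : ℕ)).symm (L⁻¹ * c * R⁻¹), ?_, ?_⟩
  · simp only [key, MulEquiv.apply_symm_apply]
    group
  · intro x hx
    simp only [key] at hx
    rw [← hx]
    symm
    rw [MulEquiv.symm_apply_eq]
    group

/-- The polyadic group `der_{θ,b}(G,·)`. -/
def der (n : ℕ) (θ : MulAut G) (b : G) (hb : θ b = b)
    (hθ : ∀ x, (θ ^ (n - 1)) x = b * x * b⁻¹) : PolyadicGroup n G where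
  op := derOp θ b
  nonempty := ⟨1⟩
  assoc x i j := by rw [derOp_splice θ b hb hθ, derOp_splice θ b hb hθ]
  existsUnique_solution := derOp_existsUnique θ b

/-- The underlying set of the group `G_p`; see the instance below. -/
def Twisted (_p : G) : Type u := G

/-- The element `x` of `G`, as an element of `G_p`. -/
def toTwisted (p x : G) : Twisted p := x

/-- The group `G_p`: the set `G` with the product `x ∗ y = x p⁻¹ y`; its identity is `p` and the
inverse of `x` is `p x⁻¹ p`. -/
instance (p : G) : Group (Twisted p) :=
  let M : Mul (Twisted p) := ⟨fun x y : G => (x * p⁻¹ * y : G)⟩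
  let O : One (Twisted p) := ⟨(p : G)⟩
  let J : Inv (Twisted p) := ⟨fun x : G => (p * x⁻¹ * p : G)⟩
  Group.ofLeftAxioms
    (fun x y z : G => show (x * p⁻¹ * y * p⁻¹ * z : G) = x * p⁻¹ * (y * p⁻¹ * z) by group)
    (fun x : G => show (p * p⁻¹ * x : G) = x by group)
    (fun x : G => show (p * x⁻¹ * p * p⁻¹ * x : G) = p by group)

theorem toTwisted_mul (p x y : G) :
    toTwisted p x * toTwisted p y = toTwisted p (x * p⁻¹ * y) := rfl

end Der

/-! ### Polyadic terms with coefficients -/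

/-- Formal expressions in constants from `G`, variables from `X`, the `n`-ary operation, and
operations `sol i a c` standing for the solution of `op (a_1, …, x, …, a_n) = c` (with `x` in
place `i`). -/
inductive RawTerm (n : ℕ) (G : Type u) (X : Type v) : Type (max u v)
  | const : G → RawTerm n G X
  | var : X → RawTerm n G X
  | op : (Fin n → RawTerm n G X) → RawTerm n G X
  | sol : Fin n → (Fin n → RawTerm n G X) → RawTerm n G X → RawTerm n G X

/-- The least congruence on formal expressions which makes the operation a polyadic group
operation, and `G → RawTerm n G X` a homomorphism. -/
inductive TermRel {G : Type u} (P : PolyadicGroup n G) (X : Type v) :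
    RawTerm n G X → RawTerm n G X → Prop
  | refl (s) : TermRel P X s s
  | symm {s t} : TermRel P X s t → TermRel P X t s
  | trans {s t r} : TermRel P X s t → TermRel P X t r → TermRel P X s r
  | op_congr {x y : Fin n → RawTerm n G X} :
      (∀ i, TermRel P X (x i) (y i)) → TermRel P X (.op x) (.op y)
  | sol_congr (i : Fin n) {x y : Fin n → RawTerm n G X} {s t : RawTerm n G X} :
      (∀ i, TermRel P X (x i) (y i)) → TermRel P X s t → TermRel P X (.sol i x s) (.sol i y t)
  | const_op (g : Fin n → G) : TermRel P X (.const (P.op g)) (.op fun i => .const (g i))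
  | assoc (x : ℕ → RawTerm n G X) (i j : Fin n) :
      TermRel P X (.op (splice .op x i)) (.op (splice .op x j))
  | op_sol (i : Fin n) (a : Fin n → RawTerm n G X) (c : RawTerm n G X) :
      TermRel P X (.op (Function.update a i (.sol i a c))) c
  | sol_op (i : Fin n) (a : Fin n → RawTerm n G X) (t : RawTerm n G X) :
      TermRel P X (.sol i a (.op (Function.update a i t))) t

section Ext

variable {G : Type u} (P : PolyadicGroup n G) (X : Type v)

/-- The congruence `TermRel`, as an equivalence relation. -/
def termSetoid : Setoid (RawTerm n G X) where
  r := TermRel P X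
  iseqv := ⟨.refl, .symm, .trans⟩

/-- The free product `G[X]` of the polyadic group `G` and the free polyadic group on `X`. Its
elements are the polyadic terms in the variables `X` with coefficients from `G`. -/
def Ext : Type (max u v) := Quotient (termSetoid P X)

variable {P X}

/-- The class of a formal expression. -/
def Ext.mk (s : RawTerm n G X) : Ext P X := Quotient.mk (termSetoid P X) s

/-- A chosen expression in a class. -/
def Ext.out (p : Ext P X) : RawTerm n G X := Quotient.out (s := termSetoid P X) p

variable (P X)

/-- The coefficient `g`, as an element of `G[X]`. -/
def Ext.coef (g : G) : Ext P X := Ext.mk (.const g)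

/-- The variable `x`, as an element of `G[X]`. -/
def Ext.var (x : X) : Ext P X := Ext.mk (.var x)

/-- The `n`-ary operation of `G[X]`. -/
def Ext.op (p : Fin n → Ext P X) : Ext P X := Ext.mk (.op fun i => (p i).out)

variable {P X}

theorem Ext.mk_eq_mk {s t : RawTerm n G X} :
    (Ext.mk s : Ext P X) = Ext.mk t ↔ TermRel P X s t :=
  ⟨fun h => Quotient.exact h, fun h => Quotient.sound h⟩

theorem Ext.mk_out (p : Ext P X) : Ext.mk p.out = p := Quotient.out_eq p

theorem Ext.mk_surj (p : Ext P X) : ∃ s, Ext.mk s = p := ⟨_, Ext.mk_out p⟩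

theorem Ext.op_mk (s : Fin n → RawTerm n G X) :
    Ext.op P X (fun i => Ext.mk (s i)) = Ext.mk (.op s) :=
  Ext.mk_eq_mk.2 (.op_congr fun _ => Ext.mk_eq_mk.1 (Ext.mk_out _))

theorem splice_map {A : Type*} {B : Type*} {opA : (Fin n → A) → A} {opB : (Fin n → B) → B}
    (φ : A → B) (h : ∀ x : Fin n → A, φ (opA x) = opB (fun i => φ (x i)))
    (x : ℕ → A) (i : Fin n) :
    (fun k => φ (splice opA x i k)) = splice opB (fun l => φ (x l)) i := by
  funext k
  simp only [splice]
  split_ifs <;> simp [h]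

theorem comp_update {A : Type*} {B : Type*} (φ : A → B) (a : Fin n → A) (i : Fin n) (x : A) :
    (fun k => φ (Function.update a i x k)) = Function.update (fun k => φ (a k)) i (φ x) := by
  funext k
  by_cases hk : k = i
  · subst hk; simp
  · simp [Function.update_of_ne hk]

variable (P X)

/-- `G[X]` is a polyadic group. -/
def Ext.polyadicGroup : PolyadicGroup n (Ext P X) where
  op := Ext.op P X
  nonempty := P.nonempty.map (Ext.coef P X)
  assoc x i j := by
    have key : ∀ i, Ext.op P X (splice (Ext.op P X) x i) =
        Ext.mk (.op (splice .op (fun l => (x l).out) i)) := by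
      intro i
      rw [← Ext.op_mk, splice_map (opB := Ext.op P X) Ext.mk (fun s => (Ext.op_mk s).symm)]
      simp only [Ext.mk_out]
    rw [key, key]
    exact Ext.mk_eq_mk.2 (.assoc _ i j)
  existsUnique_solution a c i := by
    have key : ∀ s : RawTerm n G X, Ext.op P X (Function.update a i (Ext.mk s)) =
        Ext.mk (.op (Function.update (fun k => (a k).out) i s)) := by
      intro s
      rw [← Ext.op_mk, comp_update Ext.mk]
      simp only [Ext.mk_out]
    refine ⟨Ext.mk (.sol i (fun k => (a k).out) c.out), ?_, ?_⟩
    · simp only [key]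
      exact (Ext.mk_eq_mk.2 (.op_sol i _ _)).trans (Ext.mk_out c)
    · intro x hx
      rw [← Ext.mk_out x, key, ← Ext.mk_out c, Ext.mk_eq_mk] at hx
      rw [← Ext.mk_out x, Ext.mk_eq_mk]
      exact .trans (.symm (.sol_op i _ _)) (.sol_congr i (fun _ => .refl _) hx)

/-- The value of a formal expression in a polyadic group `Q`, for given values of the constants
and of the variables. -/
def RawTerm.eval {G : Type u} {X : Type v} {H : Type w} (Q : PolyadicGroup n H) (φ : G → H)
    (y : X → H) : RawTerm n G X → H
  | .const g => φ g
  | .var x => y x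
  | .op s => Q.op fun i => (s i).eval Q φ y
  | .sol i a c => Q.sol i (fun k => (a k).eval Q φ y) (c.eval Q φ y)

variable {P X}

theorem RawTerm.eval_eq {H : Type w} {Q : PolyadicGroup n H} {φ : G → H}
    (hφ : IsHom P Q φ) (y : X → H) {s t : RawTerm n G X} (h : TermRel P X s t) :
    s.eval Q φ y = t.eval Q φ y := by
  induction h with
  | refl s => rfl
  | symm _ ih => exact ih.symm
  | trans _ _ ih1 ih2 => exact ih1.trans ih2
  | op_congr _ ih => simp only [RawTerm.eval, ih]
  | sol_congr i _ _ ih1 ih2 => simp only [RawTerm.eval, ih1, ih2]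
  | const_op g => exact hφ g
  | assoc x i j =>
    simp only [RawTerm.eval]
    rw [splice_map (opB := Q.op) (RawTerm.eval Q φ y) (fun _ => rfl),
      splice_map (opB := Q.op) (RawTerm.eval Q φ y) (fun _ => rfl)]
    exact Q.assoc _ i j
  | op_sol i a c =>
    simp only [RawTerm.eval]
    rw [comp_update (RawTerm.eval Q φ y)]
    exact Q.op_sol i _ _
  | sol_op i a t =>
    simp only [RawTerm.eval]
    rw [comp_update (RawTerm.eval Q φ y)]
    exact Q.sol_op i _ _

/-- The homomorphism `G[X] → H` with given (homomorphic) restriction to `G` and given values of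
the variables. -/
def Ext.lift {H : Type w} {Q : PolyadicGroup n H} {φ : G → H} (hφ : IsHom P Q φ) (y : X → H) :
    Ext P X → H :=
  Quotient.lift (RawTerm.eval Q φ y) (fun _ _ h => RawTerm.eval_eq hφ y h)

theorem Ext.lift_isHom {H : Type w} {Q : PolyadicGroup n H} {φ : G → H} (hφ : IsHom P Q φ)
    (y : X → H) : IsHom (Ext.polyadicGroup P X) Q (Ext.lift hφ y) := by
  intro p
  have h : p = fun i => Ext.mk (p i).out := by simp only [Ext.mk_out]
  rw [h]
  change Ext.lift hφ y (Ext.op P X fun i => Ext.mk (p i).out) = _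
  rw [Ext.op_mk]
  rfl

/-- `G[X]` has the universal property of the free product of `G` and the free polyadic group
on `X`. -/
theorem Ext.existsUnique_hom {H : Type w} (Q : PolyadicGroup n H) {φ : G → H}
    (hφ : IsHom P Q φ) (y : X → H) :
    ∃! Φ : Ext P X → H, IsHom (Ext.polyadicGroup P X) Q Φ ∧
      (∀ g, Φ (Ext.coef P X g) = φ g) ∧ ∀ x, Φ (Ext.var P X x) = y x := by
  refine ⟨Ext.lift hφ y, ⟨Ext.lift_isHom hφ y, fun _ => rfl, fun _ => rfl⟩, ?_⟩
  rintro Φ ⟨h1, h2, h3⟩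
  funext p
  obtain ⟨s, rfl⟩ := Ext.mk_surj p
  change Φ (Ext.mk s) = s.eval Q φ y
  induction s with
  | const g => exact h2 g
  | var x => exact h3 x
  | op s ih =>
    rw [← Ext.op_mk]
    refine (h1 _).trans ?_
    simp only [RawTerm.eval, ih]
  | sol i a c iha ihc =>
    simp only [RawTerm.eval, ← ihc, ← iha]
    rw [← Q.sol_op i (fun k => Φ (Ext.mk (a k))) (Φ (Ext.mk (.sol i a c)))]
    congr 1
    have h : (Ext.mk c : Ext P X) =
        Ext.op P X (fun k => Ext.mk (Function.update a i (.sol i a c) k)) := by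
      rw [Ext.op_mk]
      exact (Ext.mk_eq_mk.2 (.op_sol i a c)).symm
    rw [h]
    refine Eq.trans ?_ (h1 _).symm
    change _ = Q.op (fun k => Φ (Ext.mk (Function.update a i (.sol i a c) k)))
    rw [comp_update (fun t => Φ (Ext.mk t))]

variable (P X)

theorem isHom_id : IsHom P P id := fun _ => rfl

variable {P X}

/-- The value `p(y)` in `G` of a polyadic term at a point `y` of `G^X`. -/
def Ext.eval (p : Ext P X) (y : X → G) : G := Ext.lift (isHom_id P) y p

/-! ### Algebraic sets and coordinate polyadic groups -/

/-- The algebraic set `V_G(S)` of a system `S` of equations `p ≈ q`. -/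
def zeroLocus (S : Set (Ext P X × Ext P X)) : Set (X → G) :=
  {y | ∀ e ∈ S, e.1.eval y = e.2.eval y}

variable (P) in
/-- Algebraic sets. -/
def IsAlgebraicSet (Y : Set (X → G)) : Prop :=
  ∃ S : Set (Ext P X × Ext P X), Y = zeroLocus S

variable (X) in
/-- The Zariski topology on `G^X`: the algebraic sets are a subbase of its closed sets. -/
@[reducible] def zariski : TopologicalSpace (X → G) :=
  TopologicalSpace.generateFrom {U | IsAlgebraicSet P Uᶜ}

variable (P) in
/-- Irreducible algebraic sets: non-empty algebraic sets which are not the union of two proper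
subsets that are relatively closed in the Zariski topology. -/
def IsIrreducibleAlgebraicSet (Y : Set (X → G)) : Prop :=
  IsAlgebraicSet P Y ∧ @IsIrreducible (X → G) (zariski (P := P) X) Y

variable (P) in
/-- Every system of equations in finitely many variables with coefficients from `G` has a finite
subsystem with the same solutions. -/
def EquationalNoetherian : Prop :=
  ∀ (m : ℕ) (S : Set (Ext P (Fin m) × Ext P (Fin m))),
    ∃ S₀ ⊆ S, S₀.Finite ∧ zeroLocus S = zeroLocus S₀

variable (P) in
/-- The radical `Rad(Y)`, as an equivalence relation on `G[X]`. -/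
def radical (Y : Set (X → G)) : Setoid (Ext P X) where
  r p q := ∀ y ∈ Y, p.eval y = q.eval y
  iseqv := ⟨fun _ _ _ => rfl, fun h y hy => (h y hy).symm,
    fun h1 h2 y hy => (h1 y hy).trans (h2 y hy)⟩

variable (P) in
/-- The coordinate polyadic group `Γ(Y) = G[X] / Rad(Y)`, as a set. -/
def Coord (Y : Set (X → G)) : Type (max u v) := Quotient (radical P Y)

/-- The class of a polyadic term in `Γ(Y)`. -/
def Coord.mk (Y : Set (X → G)) (p : Ext P X) : Coord P Y := Quotient.mk (radical P Y) p

/-- A chosen term in a class. -/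
def Coord.out {Y : Set (X → G)} (p : Coord P Y) : Ext P X := Quotient.out (s := radical P Y) p

/-- The operation of `Γ(Y)` induced by that of `G[X]`. -/
def Coord.op (Y : Set (X → G)) (p : Fin n → Coord P Y) : Coord P Y :=
  Coord.mk Y (Ext.op P X fun i => (p i).out)

theorem Coord.mk_eq_mk {Y : Set (X → G)} {p q : Ext P X} :
    Coord.mk Y p = Coord.mk Y q ↔ ∀ y ∈ Y, p.eval y = q.eval y :=
  ⟨fun h => Quotient.exact h, fun h => Quotient.sound h⟩

theorem Coord.mk_out {Y : Set (X → G)} (p : Coord P Y) : Coord.mk Y p.out = p :=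
  Quotient.out_eq p

theorem Ext.eval_op (p : Fin n → Ext P X) (y : X → G) :
    (Ext.op P X p).eval y = P.op (fun i => (p i).eval y) :=
  Ext.lift_isHom (isHom_id P) y p

theorem Coord.op_mk (Y : Set (X → G)) (p : Fin n → Ext P X) :
    Coord.op Y (fun i => Coord.mk Y (p i)) = Coord.mk Y (Ext.op P X p) := by
  refine Coord.mk_eq_mk.2 fun y hy => ?_
  rw [Ext.eval_op, Ext.eval_op]
  congr 1
  funext i
  exact Coord.mk_eq_mk.1 (Coord.mk_out (Coord.mk Y (p i))) y hy

variable (P) in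
/-- The coordinate polyadic group `Γ(Y)`. -/
def Coord.polyadicGroup (Y : Set (X → G)) : PolyadicGroup n (Coord P Y) where
  op := Coord.op Y
  nonempty := (Ext.polyadicGroup P X).nonempty.map (Coord.mk Y)
  assoc x i j := by
    have key : ∀ i, Coord.op Y (splice (Coord.op Y) x i) =
        Coord.mk Y (Ext.op P X (splice (Ext.op P X) (fun l => (x l).out) i)) := by
      intro i
      rw [← Coord.op_mk, splice_map (opB := Coord.op Y) (Coord.mk Y)
        (fun s => (Coord.op_mk Y s).symm)]
      simp only [Coord.mk_out]
    rw [key, key]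
    exact congrArg _ ((Ext.polyadicGroup P X).assoc _ i j)
  existsUnique_solution a c i := by
    have key : ∀ p : Ext P X, Coord.op Y (Function.update a i (Coord.mk Y p)) =
        Coord.mk Y (Ext.op P X (Function.update (fun k => (a k).out) i p)) := by
      intro p
      rw [← Coord.op_mk, comp_update (Coord.mk Y)]
      simp only [Coord.mk_out]
    obtain ⟨p, hp, -⟩ :=
      (Ext.polyadicGroup P X).existsUnique_solution (fun k => (a k).out) c.out i
    refine ⟨Coord.mk Y p, ?_, ?_⟩
    · simp only [key]
      exact (congrArg (Coord.mk Y) hp).trans (Coord.mk_out c)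
    · intro x hx
      rw [← Coord.mk_out x, key, ← Coord.mk_out c, Coord.mk_eq_mk] at hx
      rw [← Coord.mk_out x, Coord.mk_eq_mk]
      intro y hy
      have h1 := hx y hy
      have h2 := congrArg (fun q => Ext.eval q y) hp
      change (Ext.op P X _).eval y = _ at h2
      rw [← h2, Ext.eval_op, Ext.eval_op, comp_update (fun q => Ext.eval q y),
        comp_update (fun q => Ext.eval q y)] at h1
      exact (P.existsUnique_solution _ _ i).unique h1 rfl

/-- `H`, with the map `γ : G → H` giving the values of the constants, is (isomorphic to) the
coordinate polyadic group of `Y`: there is an isomorphism `Γ(Y) → H` of polyadic groups which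
takes the class of the constant term `g` to `γ g`. -/
def IsCoordinateGroupOf {H : Type w} (P : PolyadicGroup n G) (Q : PolyadicGroup n H) (γ : G → H)
    (Y : Set (X → G)) : Prop :=
  ∃ e : Coord P Y → H, Function.Bijective e ∧ IsHom (Coord.polyadicGroup P Y) Q e ∧
    ∀ g, e (Coord.mk Y (Ext.coef P X g)) = γ g

end Ext

/-! ### Ultrapowers -/

section Ultrapower

variable {G : Type u} [Group G] {I : Type w} (F : Ultrafilter I)

/-- The ultrapower `G^I / F` of the group `G`, with the operations induced by those of `G`. -/
abbrev Ultrapower (G : Type u) : Type (max u w) := (F : Filter I).Germ G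

/-- The automorphism `θ*` of `G^I / F` induced by `θ`. -/
def ultraAut (θ : MulAut G) : MulAut (Ultrapower F G) where
  toFun := Filter.Germ.map θ
  invFun := Filter.Germ.map θ.symm
  left_inv x := by
    induction x using Filter.Germ.inductionOn with
    | _ x => simp only [Filter.Germ.map_coe]; congr 1; funext k; simp
  right_inv x := by
    induction x using Filter.Germ.inductionOn with
    | _ x => simp only [Filter.Germ.map_coe]; congr 1; funext k; simp
  map_mul' x y := by
    induction x, y using Filter.Germ.inductionOn₂ with
    | _ x y =>
      simp only [← Filter.Germ.coe_mul, Filter.Germ.map_coe]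
      congr 1; funext k; simp

theorem ultraAut_coe (θ : MulAut G) (x : I → G) :
    ultraAut F θ (x : Ultrapower F G) = ((fun k => θ (x k) : I → G) : Ultrapower F G) := rfl

theorem ultraAut_pow_coe (θ : MulAut G) (k : ℕ) (x : I → G) :
    (ultraAut F θ ^ k) (x : Ultrapower F G) =
      ((fun l => (θ ^ k) (x l) : I → G) : Ultrapower F G) := by
  induction k with
  | zero => rfl
  | succ k ih =>
    rw [pow_succ', MulAut.mul_apply, ih, ultraAut_coe]
    congr 1; funext l; rw [pow_succ', MulAut.mul_apply]

/-- The ultrapower `(G,f)^I / F` of `(G,f) = der_{θ,b}(G,·)`, which is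
`der_{θ*,(b)/F}(G^I/F,·)`. -/
def ultraDer (n : ℕ) (θ : MulAut G) (b : G) (hb : θ b = b)
    (hθ : ∀ x, (θ ^ (n - 1)) x = b * x * b⁻¹) : PolyadicGroup n (Ultrapower F G) :=
  der n (ultraAut F θ) (((fun _ => b : I → G) : Ultrapower F G))
    (by rw [ultraAut_coe, hb])
    (by
      intro x
      induction x using Filter.Germ.inductionOn with
      | _ x =>
        rw [ultraAut_pow_coe, ← Filter.Germ.coe_inv, ← Filter.Germ.coe_mul,
          ← Filter.Germ.coe_mul]
        congr 1; funext k; exact hθ (x k))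

/-- The operation of the ultrapower is the one induced by the coordinatewise operation `f`. -/
theorem ultraDer_op (θ : MulAut G) (b : G) (hb : θ b = b)
    (hθ : ∀ x, (θ ^ (n - 1)) x = b * x * b⁻¹) (x : Fin n → I → G) :
    (ultraDer F n θ b hb hθ).op (fun i => (x i : Ultrapower F G)) =
      ((fun k => (der n θ b hb hθ).op (fun i => x i k) : I → G) : Ultrapower F G) := by
  change derOp _ _ _ = (((fun k => derOp θ b fun i => x i k : I → G)) : Ultrapower F G)
  simp only [derOp, ultraAut_pow_coe]
  have key : ∀ (m : ℕ) (z : Fin m → I → G),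
      (List.ofFn fun i => (z i : Ultrapower F G)).prod =
        ((fun k => (List.ofFn fun i => z i k).prod : I → G) : Ultrapower F G) := by
    intro m
    induction m with
    | zero => intro z; simp only [List.ofFn_zero, List.prod_nil]; rfl
    | succ m ih =>
      intro z
      simp only [List.ofFn_succ, List.prod_cons]
      rw [ih fun i => z i.succ, ← Filter.Germ.coe_mul]
      rfl
  rw [key, ← Filter.Germ.coe_mul]
  rfl

/-- The polyadic group `H` with constants `γ : G → H` is, up to isomorphism over `G`, a polyadic
subgroup of the ultrapower of `(G,f) = der_{θ,b}(G,·)` with respect to `F`, and its underlying set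
`S` is an ordinary subgroup of `(G^I/F)_p` with `p θ*(h) θ*(p⁻¹) ∈ S` for all `h ∈ S`. Here a
constant from `G` is interpreted in the ultrapower as the class of the constant family. -/
def IsTwistedSubgroup {n : ℕ} (θ : MulAut G) (b : G) (hb : θ b = b)
    (hθ : ∀ x, (θ ^ (n - 1)) x = b * x * b⁻¹) {H : Type v} (Q : PolyadicGroup n H)
    (γ : G → H) (p : Ultrapower F G) : Prop :=
  ∃ (ι : H → Ultrapower F G) (S : Subgroup (Twisted p)),
    Function.Injective ι ∧ IsHom Q (ultraDer F n θ b hb hθ) ι ∧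
    (∀ g, ι (γ g) = ((fun _ => g : I → G) : Ultrapower F G)) ∧
    (∀ x : Ultrapower F G, x ∈ Set.range ι ↔ toTwisted p x ∈ S) ∧
    ∀ h : Ultrapower F G, toTwisted p h ∈ S →
      toTwisted p (p * ultraAut F θ h * ultraAut F θ p⁻¹) ∈ S

end Ultrapower

end Polyadic

end

open Polyadic

/-! Condition (∗) amounts to the existence of an embedding of `H` over `G` into an ultrapower of
`(G,f)`. The image of such an embedding contains the constants `1` and `b⁻¹`, and with these the
operation `f` expresses `x * y` and `θ x`, while inverses are solutions of equations. The image is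
therefore a subgroup of `G^I/F` stable under `θ*`, which is (∗) with `u = 1`
(`isTwistedSubgroup_of_embedding`).

Let `Y` be irreducible. The non-empty relatively open subsets of `Y` have the finite intersection
property, so some ultrafilter `F` on `Y` contains them all. Terms that differ somewhere on `Y`
differ on such an open set, hence `F`-almost everywhere, and `p ↦ (p(y))_y` embeds `Γ(Y)` into
`G^Y/F` (`exists_embedding_of_isIrreducible`).

Conversely, let `H` embed into `G^I/F`, let `S` be the set of all relations between finitely many
generators, and lift the images of the generators to families in `G`. A pair of terms is a relation
exactly when it holds at almost all of the resulting points of `G^m`. By equational noetherianity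
almost all of these points lie in `Y = V(S)`. Hence a pair outside `S` fails at some point of `Y`,
so that `Rad(Y) = S`; moreover every open set meeting `Y` is large, so that `Y` is irreducible
(`exists_isCoordinateGroupOf_of_embedding`). -/

namespace Polyadic

/-! ### Homomorphisms and values of terms -/

section Evaluation

variable {n : ℕ} {G : Type u} {P : PolyadicGroup n G}

theorem IsHom.comp {A B C : Type*} {PA : PolyadicGroup n A} {PB : PolyadicGroup n B}
    {PC : PolyadicGroup n C} {ψ : B → C} {φ : A → B} (hψ : IsHom PB PC ψ) (hφ : IsHom PA PB φ) :
    IsHom PA PC (ψ ∘ φ) := fun x => by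
  simp only [Function.comp_apply]
  rw [hφ, hψ]

/-- Solutions are unique, so a map that respects the operation automatically respects solving
equations. -/
theorem IsHom.map_sol {A B : Type*} {PA : PolyadicGroup n A} {PB : PolyadicGroup n B}
    {φ : A → B} (hφ : IsHom PA PB φ) (i : Fin n) (a : Fin n → A) (c : A) :
    φ (PA.sol i a c) = PB.sol i (fun k => φ (a k)) (φ c) := by
  have h := hφ (Function.update a i (PA.sol i a c))
  rw [PA.op_sol, comp_update φ] at h
  rw [h, PB.sol_op]

/-- The range of a homomorphism is a polyadic subgroup. -/
theorem IsHom.isPolyadicSubgroup_range {A B : Type*} {PA : PolyadicGroup n A}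
    {PB : PolyadicGroup n B} {φ : A → B} (hφ : IsHom PA PB φ) :
    IsPolyadicSubgroup PB (Set.range φ) where
  nonempty := PA.nonempty.elim fun a => ⟨φ a, a, rfl⟩
  op_mem x hx := by
    choose y hy using hx
    exact ⟨PA.op y, by rw [hφ]; simp only [hy]⟩
  solution_mem a c i x ha hc h := by
    obtain ⟨c', rfl⟩ := hc
    -- The entry `a i` is overwritten and need not lie in the range; an arbitrary element stands in
    -- for its preimage.
    have ha' : ∀ j, ∃ y, j ≠ i → φ y = a j := fun j => by
      by_cases hj : j = i
      · exact PA.nonempty.elim fun y => ⟨y, fun h => absurd hj h⟩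
      · obtain ⟨y, hy⟩ := ha j hj
        exact ⟨y, fun _ => hy⟩
    choose a' ha' using ha'
    refine ⟨PA.sol i a' c', ?_⟩
    rw [hφ.map_sol]
    refine (PB.existsUnique_solution a (φ c') i).unique ?_ h
    have : a = Function.update (fun k => φ (a' k)) i (a i) := by
      funext j
      by_cases hj : j = i
      · subst hj; simp
      · rw [Function.update_of_ne hj, ha' j hj]
    rw [this, Function.update_idem, PB.op_sol]

/-- If `H` is generated over `G` by the values `y`, then every element of `H` is the value of a
polyadic term at `y`. -/
theorem Ext.lift_surjective {X : Type w} {H : Type v} {Q : PolyadicGroup n H} {γ : G → H}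
    (hγ : IsHom P Q γ) (y : X → H)
    (hy : ∀ K : Set H, IsPolyadicSubgroup Q K → (∀ g, γ g ∈ K) → (∀ x, y x ∈ K) →
      K = Set.univ) :
    Function.Surjective (Ext.lift hγ y) := by
  rw [← Set.range_eq_univ]
  exact hy _ (Ext.lift_isHom hγ y).isPolyadicSubgroup_range
    (fun g => ⟨Ext.coef P X g, rfl⟩) (fun x => ⟨Ext.var P X x, rfl⟩)

/-- Both sides are homomorphisms on `G[X]` with the same values on constants and variables. This
carries relations in `H` over to the ultrapower. -/
theorem Ext.comp_lift {X : Type*} {H : Type*} {K : Type*} {Q : PolyadicGroup n H}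
    {R : PolyadicGroup n K} {γ : G → H} {δ : G → K} (hγ : IsHom P Q γ) (hδ : IsHom P R δ)
    {ι : H → K} (hι : IsHom Q R ι) (hc : ∀ g, ι (γ g) = δ g) (y : X → H) (p : Ext P X) :
    ι (Ext.lift hγ y p) = Ext.lift hδ (fun x => ι (y x)) p :=
  congrFun ((Ext.existsUnique_hom R hδ fun x => ι (y x)).unique
    ⟨hι.comp (Ext.lift_isHom hγ y), hc, fun _ => rfl⟩
    ⟨Ext.lift_isHom hδ _, fun _ => rfl, fun _ => rfl⟩) p

end Evaluation

/-! ### Recovering the group and `θ` from the polyadic operation -/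

section DerOp

variable {n : ℕ} {G : Type u} [Group G] (θ : MulAut G) (b : G)

theorem partialProd_one (k : ℕ) : partialProd θ (fun _ => 1) k = 1 := by
  induction k with
  | zero => rfl
  | succ k ih => simp [partialProd, ih]

/-- The operation with all entries but two equal to `1`. -/
theorem derOp_two {i j : ℕ} (hij : i < j) (hj : j < n) (x y : G) :
    derOp θ b (fun k : Fin n => if (k : ℕ) = i then x else if (k : ℕ) = j then y else 1) =
      (θ ^ i) x * (θ ^ j) y * b := by
  -- The places other than `i` and `j` form three blocks of lengths `i`, `r` and `s`, each
  -- contributing `1`.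
  obtain ⟨r, rfl⟩ : ∃ r, j = i + 1 + r := ⟨j - (i + 1), by omega⟩
  obtain ⟨s, rfl⟩ : ∃ s, n = i + 1 + r + 1 + s := ⟨n - (i + 1 + r + 1), by omega⟩
  rw [derOp_seq θ b (fun k => if k = i then x else if k = i + 1 + r then y else 1),
    partialProd_add, partialProd, partialProd_add, partialProd]
  rw [partialProd_congr θ (k := i) (y := fun _ => 1)
      (fun l hl => by rw [if_neg (by omega), if_neg (by omega)]),
    partialProd_congr θ (k := r) (y := fun _ => 1)
      (fun l hl => by rw [if_neg (by omega), if_neg (by omega)]),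
    partialProd_congr θ (k := s) (y := fun _ => 1)
      (fun l hl => by rw [if_neg (by omega), if_neg (by omega)])]
  simp only [partialProd_one, map_one, mul_one, if_true]
  rw [if_neg (by omega), one_mul]

/-- The operation with all entries but three equal to `1`. -/
theorem derOp_first_penultimate_last (hn : 2 < n) (hb : θ b = b)
    (hθ : ∀ x, (θ ^ (n - 1)) x = b * x * b⁻¹) (x y : G) :
    derOp θ b (fun k : Fin n => if (k : ℕ) = 0 then x else if (k : ℕ) = n - 2 then b⁻¹ else
      if (k : ℕ) = n - 1 then y else 1) = x * y := by
  -- The value is `x * b⁻¹ * θ^(n-1)(y) * b`, and `θ^(n-1)(y) = b * y * b⁻¹` cancels both outer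
  -- factors. As `n > 2`, the places `0`, `n - 2` and `n - 1` are distinct.
  obtain ⟨r, rfl⟩ : ∃ r, n = 1 + r + 1 + 1 := ⟨n - 3, by omega⟩
  have h1 : 1 + r + 1 + 1 - 2 = 1 + r := by omega
  have h2 : 1 + r + 1 + 1 - 1 = 1 + r + 1 := by omega
  rw [h2] at hθ
  rw [h1, h2, derOp_seq θ b (fun k => if k = 0 then x else if k = 1 + r then b⁻¹ else
      if k = 1 + r + 1 then y else 1), partialProd, partialProd, partialProd_add,
    partialProd_congr θ (k := r) (y := fun _ => 1)
      (fun l hl => by rw [if_neg (by omega), if_neg (by omega), if_neg (by omega)])]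
  rw [partialProd_one, if_neg (by omega), if_pos rfl, if_neg (by omega), if_neg (by omega),
    if_pos rfl, hθ, map_inv, pow_apply_fixed θ b hb]
  simp [partialProd, mul_assoc]

/-- A polyadic subgroup of `der_{θ,b}(G,·)` which contains `1` and `b⁻¹` is closed under the
multiplication of `G`. -/
theorem IsPolyadicSubgroup.mul_mem (hn : 2 < n) (hb : θ b = b)
    (hθ : ∀ x, (θ ^ (n - 1)) x = b * x * b⁻¹) {K : Set G}
    (hK : IsPolyadicSubgroup (der n θ b hb hθ) K) (h1 : 1 ∈ K) (hb' : b⁻¹ ∈ K)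
    {x y : G} (hx : x ∈ K) (hy : y ∈ K) : x * y ∈ K := by
  rw [← derOp_first_penultimate_last θ b hn hb hθ]
  refine hK.op_mem _ fun k => ?_
  split_ifs <;> assumption

/-- Expressing `x * x⁻¹ = 1` by the operation exhibits `x⁻¹` as the solution, in the last place, of
an equation whose other entries and value lie in `K`. -/
theorem IsPolyadicSubgroup.inv_mem (hn : 2 < n) (hb : θ b = b)
    (hθ : ∀ x, (θ ^ (n - 1)) x = b * x * b⁻¹) {K : Set G}
    (hK : IsPolyadicSubgroup (der n θ b hb hθ) K) (h1 : 1 ∈ K) (hb' : b⁻¹ ∈ K)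
    {x : G} (hx : x ∈ K) : x⁻¹ ∈ K := by
  have h := derOp_first_penultimate_last θ b hn hb hθ x x⁻¹
  rw [mul_inv_cancel] at h
  refine hK.solution_mem (fun k : Fin n => if (k : ℕ) = 0 then x else if (k : ℕ) = n - 2 then b⁻¹
    else if (k : ℕ) = n - 1 then x⁻¹ else 1) 1 ⟨n - 1, by omega⟩ x⁻¹ (fun j hj => ?_) h1 ?_
  · have : (j : ℕ) ≠ n - 1 := fun h => hj (Fin.ext h)
    split_ifs <;> assumption
  · rw [Function.update_eq_self_iff.2]
    · exact h
    · dsimp only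
      rw [if_neg (by omega), if_neg (by omega), if_pos rfl]

/-- With `x` in place `1` and `b⁻¹` in the last place, the factor `b⁻¹`, fixed by `θ`, cancels the
final `b`. -/
theorem IsPolyadicSubgroup.aut_mem (hn : 2 < n) (hb : θ b = b)
    (hθ : ∀ x, (θ ^ (n - 1)) x = b * x * b⁻¹) {K : Set G}
    (hK : IsPolyadicSubgroup (der n θ b hb hθ) K) (h1 : 1 ∈ K) (hb' : b⁻¹ ∈ K)
    {x : G} (hx : x ∈ K) : θ x ∈ K := by
  have h := derOp_two θ b (n := n) (i := 1) (j := n - 1) (by omega) (by omega) x b⁻¹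
  rw [map_inv, pow_apply_fixed θ b hb, inv_mul_cancel_right, pow_one] at h
  rw [← h]
  refine hK.op_mem _ fun k => ?_
  split_ifs <;> assumption

end DerOp

/-! ### Terms and polyadic subgroups in the ultrapower -/

section Ultrapower

variable {n : ℕ} {G : Type u} [Group G] {I : Type w} (F : Ultrafilter I)
  (θ : MulAut G) (b : G) (hb : θ b = b) (hθ : ∀ x, (θ ^ (n - 1)) x = b * x * b⁻¹)

theorem ultraDer_const_isHom :
    IsHom (der n θ b hb hθ) (ultraDer F n θ b hb hθ)
      (fun g => ((fun _ => g : I → G) : Ultrapower F G)) := fun x =>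
  (ultraDer_op F θ b hb hθ fun i _ => x i).symm

/-- The values of polyadic terms in the ultrapower are computed coordinatewise. -/
theorem lift_ultraDer {X : Type v} (x : X → I → G) (p : Ext (der n θ b hb hθ) X) :
    Ext.lift (ultraDer_const_isHom F θ b hb hθ) (fun j => (x j : Ultrapower F G)) p =
      ((fun i => p.eval fun j => x j i : I → G) : Ultrapower F G) := by
  -- Coordinatewise evaluation is also a homomorphism with these values on constants and variables,
  -- so the universal property identifies the two.
  refine congrFun ((Ext.existsUnique_hom _ (ultraDer_const_isHom F θ b hb hθ)
    fun j => (x j : Ultrapower F G)).unique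
    ⟨Ext.lift_isHom _ _, fun _ => rfl, fun _ => rfl⟩
    (y₂ := fun p => ((fun i => p.eval fun j => x j i : I → G) : Ultrapower F G))
    ⟨fun q => ?_, fun _ => rfl, fun _ => rfl⟩) p
  rw [ultraDer_op]
  exact congrArg (fun z : I → G => (z : Ultrapower F G)) (funext fun i => Ext.eval_op q _)

/-- Two terms agree in the ultrapower exactly when they agree on a large set of coordinates. -/
theorem lift_ultraDer_eq_iff {X : Type v} (x : X → I → G) (p q : Ext (der n θ b hb hθ) X) :
    Ext.lift (ultraDer_const_isHom F θ b hb hθ) (fun j => (x j : Ultrapower F G)) p =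
      Ext.lift (ultraDer_const_isHom F θ b hb hθ) (fun j => (x j : Ultrapower F G)) q ↔
    ∀ᶠ i in (F : Filter I), p.eval (fun j => x j i) = q.eval (fun j => x j i) := by
  rw [lift_ultraDer, lift_ultraDer]
  exact Filter.Germ.coe_eq

/-- A polyadic group over `G` which embeds over `G` into the ultrapower is a subgroup of
`G^I / F` stable under `θ*`. -/
theorem isTwistedSubgroup_of_embedding (hn : 2 < n) {H : Type v} {Q : PolyadicGroup n H}
    {γ : G → H} {ι : H → Ultrapower F G} (hinj : Function.Injective ι)
    (hι : IsHom Q (ultraDer F n θ b hb hθ) ι)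
    (hc : ∀ g, ι (γ g) = ((fun _ => g : I → G) : Ultrapower F G)) :
    IsTwistedSubgroup F θ b hb hθ Q γ 1 := by
  have hK := hι.isPolyadicSubgroup_range
  have h1 : (1 : Ultrapower F G) ∈ Set.range ι := ⟨γ 1, hc 1⟩
  have hb' : (((fun _ => b : I → G) : Ultrapower F G))⁻¹ ∈ Set.range ι := ⟨γ b⁻¹, hc b⁻¹⟩
  -- Products and inverses are written as they unfold in the twisted group at `1`.
  have hmul : ∀ x y : Ultrapower F G, x ∈ Set.range ι → y ∈ Set.range ι →
      x * 1⁻¹ * y ∈ Set.range ι := fun x y hx hy => by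
    rw [inv_one, mul_one]
    exact hK.mul_mem _ _ hn _ _ h1 hb' hx hy
  have hinv : ∀ x : Ultrapower F G, x ∈ Set.range ι → 1 * x⁻¹ * 1 ∈ Set.range ι := fun x hx => by
    rw [one_mul, mul_one]
    exact hK.inv_mem _ _ hn _ _ h1 hb' hx
  let S : Subgroup (Twisted (1 : Ultrapower F G)) :=
    { carrier := (Set.range ι : Set (Ultrapower F G))
      one_mem' := h1
      mul_mem' := fun {x y} => hmul x y
      inv_mem' := fun {x} => hinv x }
  refine ⟨ι, S, hinj, hι, hc, fun x => Iff.rfl, fun h hh => ?_⟩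
  change (1 * ultraAut F θ h * ultraAut F θ 1⁻¹ : Ultrapower F G) ∈ Set.range ι
  rw [inv_one, map_one, one_mul, mul_one]
  exact hK.aut_mem _ _ hn _ _ h1 hb' hh

end Ultrapower

/-! ### Irreducibility and ultrafilters -/

section Irreducible

variable {n : ℕ} {G : Type u} {P : PolyadicGroup n G} {X : Type v}

theorem isOpen_ne (p q : Ext P X) :
    @IsOpen (X → G) (zariski (P := P) X) {y | p.eval y ≠ q.eval y} := by
  refine TopologicalSpace.isOpen_generateFrom_of_mem ⟨{(p, q)}, ?_⟩
  ext y
  simp [zeroLocus]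

/-- On an irreducible set there is an ultrafilter such that any two terms which differ at a point
of the set differ on a large set. -/
theorem exists_ultrafilter_of_isIrreducible {Y : Set (X → G)}
    (hY : @IsIrreducible (X → G) (zariski (P := P) X) Y) :
    ∃ F : Ultrafilter Y, ∀ p q : Ext P X, (∃ y ∈ Y, p.eval y ≠ q.eval y) →
      ∀ᶠ y : Y in (F : Filter Y), p.eval y.1 ≠ q.eval y.1 := by
  let := zariski (P := P) X
  obtain ⟨F, hF⟩ := Ultrafilter.exists_ultrafilter_of_finite_inter_nonempty
    {V : Set Y | ∃ U : Set (X → G), IsOpen U ∧ (Y ∩ U).Nonempty ∧ V = Subtype.val ⁻¹' U}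
    (fun T hT => by
      -- Irreducibility keeps a finite intersection of open sets meeting `Y` an open set meeting
      -- `Y`; non-emptiness of `Y` starts the induction.
      have hT' : ∃ U : Set (X → G), IsOpen U ∧ (Y ∩ U).Nonempty ∧
          ⋂₀ (T : Set (Set Y)) = Subtype.val ⁻¹' U := by
        classical
        induction T using Finset.induction_on with
        | empty => exact ⟨Set.univ, isOpen_univ, by simpa using hY.1, by simp⟩
        | insert V T _ ih =>
          rw [Finset.coe_insert, Set.insert_subset_iff] at hT
          obtain ⟨U, hU, hYU, hTU⟩ := ih hT.2
          obtain ⟨U', hU', hYU', rfl⟩ := hT.1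
          refine ⟨U' ∩ U, hU'.inter hU, hY.2 _ _ hU' hU hYU' hYU, ?_⟩
          rw [Finset.coe_insert, Set.sInter_insert, hTU, Set.preimage_inter]
      obtain ⟨U, -, ⟨y, hy, hyU⟩, hTU⟩ := hT'
      exact ⟨⟨y, hy⟩, by rw [hTU]; exact hyU⟩)
  exact ⟨F, fun p q ⟨y, hy, hpq⟩ => hF ⟨_, isOpen_ne p q, ⟨y, hy, hpq⟩, rfl⟩⟩

/-- A member of an ultrafilter is irreducible if any two terms which differ at one of its points
differ on a large set. -/
theorem isIrreducible_of_ultrafilter {Y : Set (X → G)} (F : Ultrafilter (X → G)) (hY : Y ∈ F)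
    (hF : ∀ p q : Ext P X, (∃ y ∈ Y, p.eval y ≠ q.eval y) →
      ∀ᶠ y in (F : Filter (X → G)), p.eval y ≠ q.eval y) :
    @IsIrreducible (X → G) (zariski (P := P) X) Y := by
  let := zariski (P := P) X
  -- Every open set meeting `Y` is large. For a subbasic one, a point of `Y` in it violates some
  -- equation of the complementary algebraic set; that equation fails on a large set, contained in
  -- `U`.
  have key : ∀ U : Set (X → G), IsOpen U → (Y ∩ U).Nonempty → U ∈ F := by
    intro U hU
    induction hU with
    | basic U hU =>
      rintro ⟨y, hy, hyU⟩
      obtain ⟨S, hS⟩ := hU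
      have hyS : y ∉ zeroLocus S := by rw [← hS]; exact fun h => h hyU
      simp only [zeroLocus, Set.mem_ofPred_eq, not_forall] at hyS
      obtain ⟨e, he, hne⟩ := hyS
      refine Filter.mem_of_superset (hF e.1 e.2 ⟨y, hy, hne⟩) fun z hz => ?_
      by_contra hzU
      have : z ∈ zeroLocus S := by rw [← hS]; exact hzU
      exact hz (this e he)
    | univ => exact fun _ => Filter.univ_mem
    | inter U V _ _ ihU ihV =>
      rintro ⟨y, hy, hyU, hyV⟩
      exact Filter.inter_mem (ihU ⟨y, hy, hyU⟩) (ihV ⟨y, hy, hyV⟩)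
    | sUnion 𝒰 _ ih =>
      rintro ⟨y, hy, U, hU, hyU⟩
      exact Filter.mem_of_superset (ih U hU ⟨y, hy, hyU⟩) (Set.subset_sUnion_of_mem hU)
  refine ⟨F.nonempty_of_mem hY, fun U V hU hV hYU hYV => F.nonempty_of_mem ?_⟩
  exact Filter.inter_mem hY (Filter.inter_mem (key U hU hYU) (key V hV hYV))

/-- `H` is the coordinate polyadic group of the solution set of the relations between generators
of `H`, provided that every pair of terms which agrees on that set is such a relation. -/
theorem isCoordinateGroupOf_of_surjective {H : Type w} {Q : PolyadicGroup n H} {γ : G → H}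
    (hγ : IsHom P Q γ) {y : X → H} (hsurj : Function.Surjective (Ext.lift hγ y))
    {Y : Set (X → G)}
    (hY : ∀ p q : Ext P X, Ext.lift hγ y p = Ext.lift hγ y q ↔
      ∀ z ∈ Y, p.eval z = q.eval z) :
    IsCoordinateGroupOf P Q γ Y := by
  refine ⟨Quotient.lift (Ext.lift hγ y) fun p q h => (hY p q).2 h, ⟨?_, ?_⟩, ?_, fun _ => rfl⟩
  · intro p q h
    rw [← Coord.mk_out p, ← Coord.mk_out q] at h ⊢
    exact Coord.mk_eq_mk.2 ((hY _ _).1 h)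
  · intro h
    obtain ⟨p, rfl⟩ := hsurj h
    exact ⟨Coord.mk Y p, rfl⟩
  · intro p
    obtain ⟨q, rfl⟩ : ∃ q : Fin n → Ext P X, p = fun i => Coord.mk Y (q i) :=
      ⟨fun i => (p i).out, by simp only [Coord.mk_out]⟩
    change Quotient.lift _ _ (Coord.op Y fun i => Coord.mk Y (q i)) = _
    rw [Coord.op_mk]
    exact Ext.lift_isHom hγ y q

theorem FinitelyGeneratedOver.exists_fin {H : Type v} {Q : PolyadicGroup n H} {γ : G → H}
    (hH : FinitelyGeneratedOver Q γ) :
    ∃ (m : ℕ) (y : Fin m → H), 0 < m ∧ ∀ K : Set H, IsPolyadicSubgroup Q K →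
      (∀ g, γ g ∈ K) → (∀ i, y i ∈ K) → K = Set.univ := by
  obtain ⟨t, ht⟩ := hH
  obtain ⟨h₀⟩ := Q.nonempty
  -- The redundant generator `h₀` keeps the number of variables positive even when `t` is empty.
  refine ⟨t.card + 1, Fin.cons h₀ fun i => (t.equivFin.symm i : H), Nat.succ_pos _,
    fun K hK hg hy => ht K hK hg fun h hh => ?_⟩
  simpa using hy (t.equivFin ⟨h, hh⟩).succ

end Irreducible

/-! ### Coordinate groups and embeddings into ultrapowers -/

section Main

variable {n : ℕ} {G : Type u} [Group G] (θ : MulAut G) (b : G) (hb : θ b = b)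
  (hθ : ∀ x, (θ ^ (n - 1)) x = b * x * b⁻¹)

/-- The coordinate polyadic group of an irreducible set embeds into an ultrapower. -/
theorem exists_embedding_of_isIrreducible {X : Type v} {H : Type w} {Q : PolyadicGroup n H}
    {γ : G → H} {Y : Set (X → G)}
    (hY : @IsIrreducible (X → G) (zariski (P := der n θ b hb hθ) X) Y)
    (hQ : IsCoordinateGroupOf (der n θ b hb hθ) Q γ Y) :
    ∃ (F : Ultrafilter Y) (ι : H → Ultrapower F G), Function.Injective ι ∧
      IsHom Q (ultraDer F n θ b hb hθ) ι ∧
      ∀ g, ι (γ g) = ((fun _ => g : Y → G) : Ultrapower F G) := by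
  obtain ⟨F, hF⟩ := exists_ultrafilter_of_isIrreducible hY
  obtain ⟨e, he, hom, hc⟩ := hQ
  let val (p : Coord (der n θ b hb hθ) Y) : Ultrapower F G :=
    ((fun y => p.out.eval y.1 : Y → G) : Ultrapower F G)
  -- The chosen representative is immaterial: terms in one class agree at every point of `Y`.
  have hval : ∀ p, val (Coord.mk Y p) = ((fun y => p.eval y.1 : Y → G) : Ultrapower F G) := by
    intro p
    exact congrArg (fun z : Y → G => (z : Ultrapower F G)) (funext fun y =>
      Coord.mk_eq_mk.1 (Coord.mk_out (Coord.mk Y p)) y.1 y.2)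
  have hinj : Function.Injective val := by
    intro p q h
    rw [← Coord.mk_out p, ← Coord.mk_out q, Coord.mk_eq_mk]
    by_contra! hne
    -- The terms would both differ and agree on large sets, and two large sets meet.
    obtain ⟨y, hy⟩ := ((hF _ _ hne).and (Filter.Germ.coe_eq.1 h)).exists
    exact hy.1 hy.2
  have hhom : IsHom (Coord.polyadicGroup (der n θ b hb hθ) Y) (ultraDer F n θ b hb hθ) val := by
    intro p
    refine (hval _).trans ?_
    rw [ultraDer_op]
    exact congrArg (fun z : Y → G => (z : Ultrapower F G)) (funext fun y => Ext.eval_op _ _)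
  let E := Equiv.ofBijective e he
  refine ⟨F, fun h => val (E.symm h), hinj.comp E.symm.injective, fun h => ?_, fun g => ?_⟩
  · rw [← hhom]
    refine congrArg val ?_
    rw [Equiv.symm_apply_eq]
    refine Eq.trans ?_ (hom _).symm
    congr 1
    funext i
    exact (E.apply_symm_apply (h i)).symm
  · have : E.symm (γ g) = Coord.mk Y (Ext.coef _ X g) := by
      rw [Equiv.symm_apply_eq]
      exact (hc g).symm
    simp only [this, hval]
    rfl

/-- A finitely generated polyadic group over an equational noetherian `G` which embeds into an
ultrapower is the coordinate polyadic group of an irreducible algebraic set. -/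
theorem exists_isCoordinateGroupOf_of_embedding (hN : EquationalNoetherian (der n θ b hb hθ))
    {H : Type v} {Q : PolyadicGroup n H} {γ : G → H} (hγ : IsHom (der n θ b hb hθ) Q γ)
    (hH : FinitelyGeneratedOver Q γ) {I : Type w} (F : Ultrafilter I) {ι : H → Ultrapower F G}
    (hinj : Function.Injective ι) (hι : IsHom Q (ultraDer F n θ b hb hθ) ι)
    (hc : ∀ g, ι (γ g) = ((fun _ => g : I → G) : Ultrapower F G)) :
    ∃ (m : ℕ) (Y : Set (Fin m → G)), 0 < m ∧
      IsIrreducibleAlgebraicSet (der n θ b hb hθ) Y ∧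
      IsCoordinateGroupOf (der n θ b hb hθ) Q γ Y := by
  obtain ⟨m, y, hm, hy⟩ := hH.exists_fin
  have hx : ∀ j, ∃ x : I → G, (x : Ultrapower F G) = ι (y j) := fun j =>
    Quotient.exists_rep (ι (y j))
  choose x hx using hx
  have los : ∀ p q : Ext (der n θ b hb hθ) (Fin m), Ext.lift hγ y p = Ext.lift hγ y q ↔
      ∀ᶠ i in (F : Filter I), p.eval (fun j => x j i) = q.eval (fun j => x j i) := by
    intro p q
    rw [← hinj.eq_iff, Ext.comp_lift hγ (ultraDer_const_isHom F θ b hb hθ) hι hc,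
      Ext.comp_lift hγ (ultraDer_const_isHom F θ b hb hθ) hι hc]
    simp only [← hx]
    exact lift_ultraDer_eq_iff F θ b hb hθ x p q
  set S : Set (Ext (der n θ b hb hθ) (Fin m) × Ext (der n θ b hb hθ) (Fin m)) :=
    {e | Ext.lift hγ y e.1 = Ext.lift hγ y e.2} with hS
  obtain ⟨S₀, hS₀, hfin, hV⟩ := hN m S
  -- Each relation holds for almost all `i`, but only finitely many can be imposed at once; the
  -- noetherian property reduces `S` to `S₀`.
  have hYF : ∀ᶠ i in (F : Filter I), (fun j => x j i) ∈ zeroLocus S := by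
    rw [hV]
    exact (Filter.eventually_all_finite hfin).2 fun e he => (los _ _).1 (hS₀ he)
  have hne : ∀ p q : Ext (der n θ b hb hθ) (Fin m), Ext.lift hγ y p ≠ Ext.lift hγ y q →
      ∀ᶠ i in (F : Filter I), p.eval (fun j => x j i) ≠ q.eval (fun j => x j i) :=
    fun p q h => Ultrafilter.eventually_not.2 fun h' => h ((los p q).2 h')
  refine ⟨m, zeroLocus S, hm, ⟨⟨S, rfl⟩, ?_⟩, ?_⟩
  -- The ultrafilter on `G^m` is the image of `F` under `i ↦ (x j i)_j`. A pair that differs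
  -- somewhere on the zero locus is not in `S`, hence differs almost everywhere.
  · refine isIrreducible_of_ultrafilter (F.map fun i j => x j i) hYF ?_
    rintro p q ⟨z, hz, hpq⟩
    exact hne p q fun h => hpq (hz (p, q) h)
  · refine isCoordinateGroupOf_of_surjective hγ (Ext.lift_surjective hγ y hy) fun p q =>
      ⟨fun h z hz => hz (p, q) h, fun h => ?_⟩
    by_contra hpq
    -- A non-relation fails at almost every point `(x j i)_j`, and almost all of these lie in the
    -- zero locus.
    obtain ⟨i, hi, hi'⟩ := (hYF.and (hne p q hpq)).exists
    exact hi' (h _ hi)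

end Main

end Polyadic

theorem theorem5p4 {n : ℕ} (hn : 2 < n) {G : Type u} [Group G] (θ : MulAut G) (b : G)
    (hb : θ b = b) (hθ : ∀ x, (θ ^ (n - 1)) x = b * x * b⁻¹)
    (hN : EquationalNoetherian (der n θ b hb hθ))
    {H : Type v} (Q : PolyadicGroup n H) (γ : G → H) (hγ : IsHom (der n θ b hb hθ) Q γ) :
    ((∃ (m : ℕ) (Y : Set (Fin m → G)), IsIrreducibleAlgebraicSet (der n θ b hb hθ) Y ∧
        IsCoordinateGroupOf (der n θ b hb hθ) Q γ Y) →
      ∃ (I : Type u) (F : Ultrafilter I) (p : Ultrapower F G),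
        IsTwistedSubgroup F θ b hb hθ Q γ p) ∧
    (FinitelyGeneratedOver Q γ →
      (∃ (I : Type w) (F : Ultrafilter I) (p : Ultrapower F G),
        IsTwistedSubgroup F θ b hb hθ Q γ p) →
      ∃ (m : ℕ) (Y : Set (Fin m → G)), 0 < m ∧
        IsIrreducibleAlgebraicSet (der n θ b hb hθ) Y ∧
        IsCoordinateGroupOf (der n θ b hb hθ) Q γ Y) := by

  refine ⟨?_, ?_⟩
  · rintro ⟨m, Y, ⟨-, hY⟩, hQ⟩
    obtain ⟨F, ι, hinj, hι, hc⟩ := exists_embedding_of_isIrreducible θ b hb hθ hY hQ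
    -- The index set is `Y` itself and the twisting element is `1`.
    exact ⟨Y, F, 1, isTwistedSubgroup_of_embedding F θ b hb hθ hn hinj hι hc⟩
  · rintro hH ⟨I, F, p, ι, S, hinj, hι, hc, -, -⟩
    exact exists_isCoordinateGroupOf_of_embedding θ b hb hθ hN hγ hH F hinj hι hc
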